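/- A permutation $\pi=\pi_1\cdots\pi_n$ of $\{1,\dots,n\}$ is \emph{up-down} if $\pi_1<\pi_2>\pi_3<\pi_4>\cdots$ and \emph{down-up} if $\pi_1>\pi_2<\pi_3>\pi_4<\cdots$; let $UD_n$ and $DU_n$ denote the sets of up-down and down-up permutations of length $n$. Let $\mathrm{lrmax}(\pi)$ (resp. $\mathrm{rlmax}(\pi)$) be the number of entries of $\pi$ that are greater than every entry to their left (resp. right). Define \begin{align*} G^{(1)}(t,p,q)&=1+\sum_{n\ge1}\frac{t^{2n}}{(2n)!}\sum_{\pi\in UD_{2n}}p^{\mathrm{lrmax}(\pi)}q^{\mathrm{rlmax}(\pi)},& G^{(2)}(t,p,q)&=\sum_{n\ge1}\frac{t^{2n-1}}{(2n-1)!}\sum_{\pi\in UD_{2n-1}}p^{\mathrm{lrmax}(\pi)}q^{\mathrm{rlmax}(\pi)},\\ G^{(3)}(t,p,q)&=1+\sum_{n\ge1}\frac{t^{2n}}{(2n)!}\sum_{\pi\in DU_{2n}}p^{\mathrm{lrmax}(\pi)}q^{\mathrm{rlmax}(\pi)},& G^{(4)}(t,p,q)&=\sum_{n\ge1}\frac{t^{2n-1}}{(2n-1)!}\sum_{\pi\in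 DU_{2n-1}}p^{\mathrm{lrmax}(\pi)}q^{\mathrm{rlmax}(\pi)}. \end{align*} \textbf{Theorem.} Let $p,q,t$ be complex numbers with $p,q\neq0$ and $|t|<\pi/2$. Then the four series converge absolutely and \begin{align*} G^{(1)}(t,p,q)&=1+\int_{0}^{pqt}\Big(\sec \frac{s}{pq}\Big)^{p+q}\int_{0}^{s/q}\Big(\sec \frac{z}{p}\Big)^{-p}dz\,ds,\\ G^{(2)}(t,p,q)&=pqt+\int_{0}^{pqt}\Big(\sec \frac{s}{pq}\Big)^{p+q}\left(\int_{0}^{s/q}\Big(\sec \frac{z}{p}\Big)^{-p}dz\right)\left(\int_{0}^{s/p}\Big(\sec \frac{z}{q}\Big)^{-q}dz\right)ds,\\ G^{(3)}(t,p,q)&=1+\int_{0}^{pqt}\Big(\sec \frac{s}{pq}\Big)^{p+q}\int_{0}^{s/p}\Big(\sec \frac{z}{q}\Big)^{-q}dz\,ds,\\ G^{(4)}(t,p,q)&=\int_{0}^{pqt}\Big(\sec \frac{z}{pq}\Big)^{p+q}dz. \end{align*} Here the integrals are taken along straight segments (for real $p,q,t$ they are ordinary integrals), and the powers are principal values, the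 secants occurring having positive real part. -/

import Mathlib

open Finset

namespace AltPerm

/-- `π₁ < π₂ > π₃ < π₄ > ⋯`. Positions are numbered from `0`, so that the first position is even. -/
def IsUpDown {n : ℕ} (π : Equiv.Perm (Fin n)) : Prop :=
  ∀ i j : Fin n, (i : ℕ) + 1 = j → if Even (i : ℕ) then π i < π j else π j < π i

/-- `π₁ > π₂ < π₃ > π₄ < ⋯`. Positions are numbered from `0`, so that the first position is even. -/
def IsDownUp {n : ℕ} (π : Equiv.Perm (Fin n)) : Prop :=
  ∀ i j : Fin n, (i : ℕ) + 1 = j → if Even (i : ℕ) then π j < π i else π i < π j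

instance {n : ℕ} : DecidablePred (IsUpDown (n := n)) := fun π => by
  unfold IsUpDown; infer_instance

instance {n : ℕ} : DecidablePred (IsDownUp (n := n)) := fun π => by
  unfold IsDownUp; infer_instance

/-- The set of up-down permutations of length `n`. -/
def UD (n : ℕ) : Finset (Equiv.Perm (Fin n)) := univ.filter fun π => IsUpDown π

/-- The set of down-up permutations of length `n`. -/
def DU (n : ℕ) : Finset (Equiv.Perm (Fin n)) := univ.filter fun π => IsDownUp π

/-- The number of left-to-right maxima: entries greater than every entry to their left. -/
def lrmax {n : ℕ} (π : Equiv.Perm (Fin n)) : ℕ :=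
  #{i : Fin n | ∀ j : Fin n, j < i → π j < π i}

/-- The number of right-to-left maxima: entries greater than every entry to their right. -/
def rlmax {n : ℕ} (π : Equiv.Perm (Fin n)) : ℕ :=
  #{i : Fin n | ∀ j : Fin n, i < j → π j < π i}

/-- The joint distribution polynomial of `(lrmax, rlmax)` on up-down permutations of length `m`. -/
noncomputable def udPoly (m : ℕ) (p q : ℂ) : ℂ := ∑ π ∈ UD m, p ^ lrmax π * q ^ rlmax π

/-- The joint distribution polynomial of `(lrmax, rlmax)` on down-up permutations of length `m`. -/
noncomputable def duPoly (m : ℕ) (p q : ℂ) : ℂ := ∑ π ∈ DU m, p ^ lrmax π * q ^ rlmax π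

/-! The `k`-th term (`k = 0, 1, 2, …`, with `n = k + 1 ≥ 1`) of each of the four series:
lengths `2n = 2k + 2` and `2n - 1 = 2k + 1`. -/

noncomputable def term1 (t p q : ℂ) (k : ℕ) : ℂ :=
  udPoly (2 * k + 2) p q * (t ^ (2 * k + 2) / (Nat.factorial (2 * k + 2) : ℂ))

noncomputable def term2 (t p q : ℂ) (k : ℕ) : ℂ :=
  udPoly (2 * k + 1) p q * (t ^ (2 * k + 1) / (Nat.factorial (2 * k + 1) : ℂ))

noncomputable def term3 (t p q : ℂ) (k : ℕ) : ℂ :=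
  duPoly (2 * k + 2) p q * (t ^ (2 * k + 2) / (Nat.factorial (2 * k + 2) : ℂ))

noncomputable def term4 (t p q : ℂ) (k : ℕ) : ℂ :=
  duPoly (2 * k + 1) p q * (t ^ (2 * k + 1) / (Nat.factorial (2 * k + 1) : ℂ))

/-- Generating function of `(lrmax, rlmax)` on up-down permutations of even length. -/
noncomputable def G1 (t p q : ℂ) : ℂ := 1 + ∑' k, term1 t p q k

/-- Generating function of `(lrmax, rlmax)` on up-down permutations of odd length. -/
noncomputable def G2 (t p q : ℂ) : ℂ := ∑' k, term2 t p q k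

/-- Generating function of `(lrmax, rlmax)` on down-up permutations of even length. -/
noncomputable def G3 (t p q : ℂ) : ℂ := 1 + ∑' k, term3 t p q k

/-- Generating function of `(lrmax, rlmax)` on down-up permutations of odd length. -/
noncomputable def G4 (t p q : ℂ) : ℂ := ∑' k, term4 t p q k

/-- The secant function. -/
noncomputable def sec (z : ℂ) : ℂ := (Complex.cos z)⁻¹

/-- `∫₀ʷ f(z) dz` along the straight segment `z = u w`, `0 ≤ u ≤ 1`. -/
noncomputable def integralTo (w : ℂ) (f : ℂ → ℂ) : ℂ :=
  ∫ u in (0 : ℝ)..1, f ((u : ℂ) * w) * w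

/-- For real endpoint and a real variable of integration this is the usual integral. -/
theorem integralTo_ofReal (x : ℝ) (f : ℂ → ℂ) :
    integralTo (x : ℂ) f = ∫ z in (0 : ℝ)..x, f (z : ℂ) := by
  have h := intervalIntegral.smul_integral_comp_mul_right (a := 0) (b := 1)
    (fun z : ℝ => f (z : ℂ)) x
  simp only [zero_mul, one_mul, Complex.ofReal_mul] at h
  rw [← h, integralTo, intervalIntegral.integral_mul_const, Complex.real_smul, mul_comm]

end AltPerm

/-!
A permutation is split at its largest letter, `π = σ n τ`. Then `lrmax π = lrmax σ + 1` and
`rlmax π = rlmax τ + 1`; the largest letter is a peak unless the length is `1`; and `τ`, which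
starts at a valley, is up-down. Counting the ways to distribute the other letters gives a binomial
recursion, `altPoly_succ`, in which `σ` only carries the variable `p` and `τ` only carries `q`.
Split by the parity of the length, it says that the derivatives of the four generating functions
are products (plus `p q` in the case of `G2`)
`G1' = p q O_p E_q`, `G2' = p q + p q O_p O_q`, `G3' = p q E_p O_q`, `G4' = p q E_p E_q`
of one-sided generating functions. The same recursion at `q = 1` or `p = 1` gives `E_p' = p E_p T`
and `O_p' = p + p O_p T`, where `T' = 1 + T ^ 2`. Hence `T = tan`, `E_p = sec ^ p` and
`O_p = sec ^ p ∫ p cos ^ p`.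

No formal power series are needed. The functions on the right-hand sides are holomorphic on the disc
`|t| < π / 2`, so their Taylor series converge there (`IsEGF.hasSum`), and by Leibniz' rule their
derivatives at `0` obey the recursions of the combinatorial sequences (`isEGF_of_hasDerivAt`).
-/

open Finset

namespace AltPerm

/-! ### Alternating words and their maxima -/

/-- The word `f` alternates. The phase `c` matters only modulo `2`: there is an ascent after
position `i` if `i + c` is even and a descent otherwise, so that phase `0` is up-down and
phase `1` is down-up. -/
def Alternates {α : Type*} [LinearOrder α] (c : ℕ) {n : ℕ} (f : Fin n → α) : Prop :=
  ∀ i j : Fin n, (i : ℕ) + 1 = j → if Even ((i : ℕ) + c) then f i < f j else f j < f i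

/-- The number of left-to-right maxima of a word. -/
def leftMax {α : Type*} [LinearOrder α] {n : ℕ} (f : Fin n → α) : ℕ :=
  #{i : Fin n | ∀ j : Fin n, j < i → f j < f i}

/-- The number of right-to-left maxima of a word. -/
def rightMax {α : Type*} [LinearOrder α] {n : ℕ} (f : Fin n → α) : ℕ :=
  #{i : Fin n | ∀ j : Fin n, i < j → f j < f i}

open Classical in
/-- The weight `p ^ lrmax * q ^ rlmax` of a word that alternates with phase `c`, and `0` for all
other words. -/
noncomputable def weight {α : Type*} [LinearOrder α] (c : ℕ) {n : ℕ} (f : Fin n → α) (p q : ℂ) :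
    ℂ :=
  if Alternates c f then p ^ leftMax f * q ^ rightMax f else 0

/-- The joint distribution polynomial of `(lrmax, rlmax)` on the permutations of length `n` that
alternate with phase `c`. -/
noncomputable def altPoly (c n : ℕ) (p q : ℂ) : ℂ :=
  ∑ π : Equiv.Perm (Fin n), weight c π p q

theorem udPoly_eq_altPoly (n : ℕ) (p q : ℂ) : udPoly n p q = altPoly 0 n p q := by
  classical
  rw [udPoly, UD, altPoly, sum_filter]
  exact sum_congr rfl fun π _ => if_congr Iff.rfl rfl rfl

theorem duPoly_eq_altPoly (n : ℕ) (p q : ℂ) : duPoly n p q = altPoly 1 n p q := by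
  classical
  rw [duPoly, DU, altPoly, sum_filter]
  refine sum_congr rfl fun π _ => if_congr ?_ rfl rfl
  refine forall_congr' fun i => forall_congr' fun j => imp_congr_right fun _ => ?_
  by_cases h : Even (i : ℕ) <;> simp [h, Nat.even_add_one]

theorem alternates_add_two_mul {α : Type*} [LinearOrder α] {n : ℕ} (c k : ℕ) (f : Fin n → α) :
    Alternates (c + 2 * k) f ↔ Alternates c f := by
  have h (i : ℕ) : Even (i + (c + 2 * k)) ↔ Even (i + c) := by grind
  simp only [Alternates, h]

theorem weight_add_two_mul {α : Type*} [LinearOrder α] {n : ℕ} (c k : ℕ) (f : Fin n → α)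
    (p q : ℂ) : weight (c + 2 * k) f p q = weight c f p q := by
  classical
  exact if_congr (alternates_add_two_mul c k f) rfl rfl

/-- Alternation and the two statistics depend only on the relative order of the letters. -/
theorem weight_comp_strictMono {α β : Type*} [LinearOrder α] [LinearOrder β] {g : α → β}
    (hg : StrictMono g) (c : ℕ) {n : ℕ} (f : Fin n → α) (p q : ℂ) :
    weight c (fun i => g (f i)) p q = weight c f p q := by
  classical
  refine if_congr ?_ ?_ rfl
  · simp only [Alternates, hg.lt_iff_lt]
  · simp only [leftMax, rightMax, hg.lt_iff_lt]

/-! ### Splitting a word at its largest letter -/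

/-- The positions before position `a` of a word of length `a + b + 1`. -/
def leftPos (a b : ℕ) (k : Fin a) : Fin (a + b + 1) := ⟨k, by omega⟩

/-- The positions after position `a` of a word of length `a + b + 1`. -/
def rightPos (a b : ℕ) (k : Fin b) : Fin (a + b + 1) := ⟨a + 1 + k, by omega⟩

/-- Position `a` of a word of length `a + b + 1`. -/
def midPos (a b : ℕ) : Fin (a + b + 1) := ⟨a, by omega⟩

theorem leftPos_or_midPos_or_rightPos {a b : ℕ} (i : Fin (a + b + 1)) :
    (∃ k, i = leftPos a b k) ∨ i = midPos a b ∨ ∃ k, i = rightPos a b k := by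
  obtain ⟨i, hi⟩ := i
  rcases lt_trichotomy i a with h | h | h
  · exact .inl ⟨⟨i, h⟩, rfl⟩
  · exact .inr (.inl (Fin.ext h))
  · exact .inr (.inr ⟨⟨i - (a + 1), by omega⟩, Fin.ext (by simp [rightPos]; omega)⟩)

section Split

variable {α : Type*} [LinearOrder α] {a b : ℕ} {f : Fin (a + b + 1) → α}

theorem leftMax_split (hf : ∀ i, i ≠ midPos a b → f i < f (midPos a b)) :
    leftMax f = leftMax (fun k => f (leftPos a b k)) + 1 := by
  have hinj : Function.Injective (leftPos a b) := fun x y h => by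
    simpa [leftPos, Fin.ext_iff] using h
  rw [leftMax, leftMax, ← card_image_of_injective _ hinj, ← card_insert_of_notMem (a := midPos a b)]
  · congr 1
    ext i
    simp only [mem_filter, mem_univ, true_and, mem_insert, mem_image]
    constructor
    · intro h
      rcases leftPos_or_midPos_or_rightPos i with ⟨k, rfl⟩ | rfl | ⟨k, rfl⟩
      · exact .inr ⟨k, fun j hj => h (leftPos a b j) hj, rfl⟩
      · exact .inl rfl
      · refine absurd (h (midPos a b) ?_) (hf _ ?_).not_gt
        · simp [midPos, rightPos, Fin.lt_def]; omega
        · simp [midPos, rightPos, Fin.ext_iff]; omega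
    · rintro (rfl | ⟨k, hk, rfl⟩) j hj
      · exact hf _ hj.ne
      · have : (j : ℕ) < k := hj
        exact hk ⟨j, by omega⟩ this
  · simp only [mem_image, not_exists, not_and]
    intro k _ h
    have : (k : ℕ) = a := congrArg Fin.val h
    omega

theorem rightMax_split (hf : ∀ i, i ≠ midPos a b → f i < f (midPos a b)) :
    rightMax f = rightMax (fun k => f (rightPos a b k)) + 1 := by
  have hinj : Function.Injective (rightPos a b) := fun x y h => by
    simpa [rightPos, Fin.ext_iff] using h
  rw [rightMax, rightMax, ← card_image_of_injective _ hinj,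
    ← card_insert_of_notMem (a := midPos a b)]
  · congr 1
    ext i
    simp only [mem_filter, mem_univ, true_and, mem_insert, mem_image]
    constructor
    · intro h
      rcases leftPos_or_midPos_or_rightPos i with ⟨k, rfl⟩ | rfl | ⟨k, rfl⟩
      · refine absurd (h (midPos a b) ?_) (hf _ ?_).not_gt
        · simp [midPos, leftPos, Fin.lt_def]
        · simp [midPos, leftPos, Fin.ext_iff]; omega
      · exact .inl rfl
      · exact .inr ⟨k, fun j hj => h (rightPos a b j) (Nat.add_lt_add_left hj _), rfl⟩
    · rintro (rfl | ⟨k, hk, rfl⟩) j hj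
      · exact hf _ hj.ne'
      · have hj' : a + 1 + (k : ℕ) < j := hj
        have := hk ⟨j - (a + 1), by omega⟩ (by simp [Fin.lt_def]; omega)
        convert this using 2
        simp [rightPos, Fin.ext_iff]; omega
  · simp only [mem_image, not_exists, not_and]
    intro k _ h
    have : a + 1 + (k : ℕ) = a := congrArg Fin.val h
    omega

/-- The largest letter must be a peak, that is `a + c` is odd, unless it has no neighbours. -/
theorem alternates_split (hf : ∀ i, i ≠ midPos a b → f i < f (midPos a b)) (c : ℕ) :
    Alternates c f ↔ (a + b = 0 ∨ Odd (a + c)) ∧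
      Alternates c (fun k => f (leftPos a b k)) ∧
      Alternates (c + a + 1) (fun k => f (rightPos a b k)) := by
  constructor
  · intro h
    refine ⟨?_, fun i j hij => h (leftPos a b i) (leftPos a b j) hij, fun i j hij => ?_⟩
    · rcases Nat.eq_zero_or_pos b with hb | hb
      · rcases Nat.eq_zero_or_pos a with ha | ha
        · exact .inl (by omega)
        · right
          have h1 := h (leftPos a b ⟨a - 1, by omega⟩) (midPos a b)
            (by simp [leftPos, midPos]; omega)
          have h2 := hf (leftPos a b ⟨a - 1, by omega⟩)
            (by simp [leftPos, midPos, Fin.ext_iff]; omega)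
          split_ifs at h1 with he
          · simp only [leftPos] at he
            grind
          · exact absurd h1 h2.not_gt
      · right
        have h1 := h (midPos a b) (rightPos a b ⟨0, hb⟩) (by simp [rightPos, midPos])
        have h2 := hf (rightPos a b ⟨0, hb⟩) (by simp [rightPos, midPos, Fin.ext_iff])
        split_ifs at h1 with he
        · exact absurd h1 h2.not_gt
        · simp only [midPos] at he
          grind
    · have h1 := h (rightPos a b i) (rightPos a b j) (by simp [rightPos]; omega)
      have h2 : (rightPos a b i : ℕ) + c = i + (c + a + 1) := by simp [rightPos]; omega
      rwa [h2] at h1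
  · rintro ⟨hodd, hl, hr⟩ i j hij
    rcases leftPos_or_midPos_or_rightPos i with ⟨k, rfl⟩ | rfl | ⟨k, rfl⟩ <;>
    rcases leftPos_or_midPos_or_rightPos j with ⟨l, rfl⟩ | rfl | ⟨l, rfl⟩ <;>
    simp only [leftPos, rightPos, midPos] at hij
    · exact hl k l hij
    · have : Even ((leftPos a b k : ℕ) + c) := by
        simp only [leftPos]
        grind
      rw [if_pos this]
      exact hf _ (by simp [leftPos, midPos, Fin.ext_iff]; omega)
    · omega
    · omega
    · omega
    · have : ¬ Even ((midPos a b : ℕ) + c) := by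
        simp only [midPos]
        grind
      rw [if_neg this]
      exact hf _ (by simp [rightPos, midPos, Fin.ext_iff]; omega)
    · omega
    · omega
    · have h1 := hr k l (by omega)
      have h2 : (rightPos a b k : ℕ) + c = k + (c + a + 1) := by simp [rightPos]; omega
      rwa [h2]

open Classical in
theorem weight_split (hf : ∀ i, i ≠ midPos a b → f i < f (midPos a b)) (c : ℕ) (p q : ℂ) :
    weight c f p q = if a + b = 0 ∨ Odd (a + c) then
      p * q * (weight c (fun k => f (leftPos a b k)) p 1 *
        weight (c + a + 1) (fun k => f (rightPos a b k)) 1 q) else 0 := by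
  simp only [weight, alternates_split hf c, leftMax_split hf, rightMax_split hf]
  by_cases h0 : a + b = 0 ∨ Odd (a + c)
  · by_cases h1 : Alternates c fun k => f (leftPos a b k)
    · by_cases h2 : Alternates (c + a + 1) fun k => f (rightPos a b k)
      · simp only [h0, h1, h2, and_self, if_true, one_pow]
        ring
      · simp [h2]
    · simp [h1]
  · simp only [h0, false_and, if_false]

end Split

/-! ### Building a permutation from its two sides -/

/-- The permutation of length `n + 1` with largest letter at position `i` and with the remaining
letters arranged as in `ρ`. -/
def insertTop {n : ℕ} (i : Fin (n + 1)) (ρ : Equiv.Perm (Fin n)) : Equiv.Perm (Fin (n + 1)) :=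
  (finSuccEquiv' i).trans ((Equiv.optionCongr ρ).trans (finSuccEquiv' (Fin.last n)).symm)

theorem insertTop_self {n : ℕ} (i : Fin (n + 1)) (ρ : Equiv.Perm (Fin n)) :
    insertTop i ρ i = Fin.last n := by
  simp [insertTop]

theorem insertTop_succAbove {n : ℕ} (i : Fin (n + 1)) (ρ : Equiv.Perm (Fin n)) (j : Fin n) :
    insertTop i ρ (i.succAbove j) = (ρ j).castSucc := by
  simp [insertTop]

theorem bijective_insertTop (n : ℕ) :
    Function.Bijective fun x : Fin (n + 1) × Equiv.Perm (Fin n) => insertTop x.1 x.2 := by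
  rw [Fintype.bijective_iff_injective_and_card]
  constructor
  · rintro ⟨i, ρ⟩ ⟨j, θ⟩ (h : insertTop i ρ = insertTop j θ)
    obtain rfl : i = j := (insertTop j θ).injective (by
      rw [insertTop_self, ← h, insertTop_self])
    refine Prod.ext rfl (Equiv.ext fun k => Fin.castSucc_injective _ ?_)
    rw [← insertTop_succAbove, h, insertTop_succAbove]
  · simp [Fintype.card_perm, Nat.factorial_succ]

/-- The permutation of length `a + b` whose first `a` letters are the elements of `S` arranged as
in `σ`, and whose last `b` letters are the other ones arranged as in `τ`. -/
def shuffle {a b : ℕ} (S : {S : Finset (Fin (a + b)) // #S = a}) (σ : Equiv.Perm (Fin a))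
    (τ : Equiv.Perm (Fin b)) : Equiv.Perm (Fin (a + b)) :=
  finSumFinEquiv.symm.trans ((Equiv.sumCongr σ τ).trans
    (finSumEquivOfFinset S.2 (by rw [card_compl, S.2, Fintype.card_fin]; omega)))

theorem shuffle_castAdd {a b : ℕ} (S : {S : Finset (Fin (a + b)) // #S = a})
    (σ : Equiv.Perm (Fin a)) (τ : Equiv.Perm (Fin b)) (k : Fin a) :
    shuffle S σ τ (Fin.castAdd b k) = S.1.orderEmbOfFin S.2 (σ k) := by
  simp [shuffle]

theorem shuffle_natAdd {a b : ℕ} (S : {S : Finset (Fin (a + b)) // #S = a})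
    (σ : Equiv.Perm (Fin a)) (τ : Equiv.Perm (Fin b)) (k : Fin b) :
    shuffle S σ τ (Fin.natAdd a k) = S.1ᶜ.orderEmbOfFin
      (by rw [card_compl, S.2, Fintype.card_fin]; omega) (τ k) := by
  simp [shuffle]

theorem bijective_shuffle (a b : ℕ) :
    Function.Bijective fun x : {S : Finset (Fin (a + b)) // #S = a} × Equiv.Perm (Fin a) ×
      Equiv.Perm (Fin b) => shuffle x.1 x.2.1 x.2.2 := by
  rw [Fintype.bijective_iff_injective_and_card]
  constructor
  · rintro ⟨S, σ, τ⟩ ⟨S', σ', τ'⟩ (h : shuffle S σ τ = shuffle S' σ' τ')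
    have himage (S : {S : Finset (Fin (a + b)) // #S = a}) (σ : Equiv.Perm (Fin a))
        (τ : Equiv.Perm (Fin b)) :
        univ.image (fun k => shuffle S σ τ (Fin.castAdd b k)) = S.1 := by
      simp_rw [shuffle_castAdd]
      rw [← coe_inj, coe_image, coe_univ, Set.image_univ]
      exact (σ.surjective.range_comp _).trans (S.1.range_orderEmbOfFin S.2)
    obtain rfl : S = S' := Subtype.ext (by rw [← himage S σ τ, h, himage])
    refine Prod.ext rfl (Prod.ext (Equiv.ext fun k => ?_) (Equiv.ext fun k => ?_))
    · apply (S.1.orderEmbOfFin S.2).injective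
      rw [← shuffle_castAdd S σ τ, h, shuffle_castAdd]
    · apply (S.1ᶜ.orderEmbOfFin (by rw [card_compl, S.2, Fintype.card_fin]; omega)).injective
      rw [← shuffle_natAdd S σ τ, h, shuffle_natAdd]
  · rw [Fintype.card_prod, Fintype.card_prod, Fintype.card_finset_len]
    simp only [Fintype.card_perm, Fintype.card_fin]
    rw [← mul_assoc]
    rw [Nat.choose_symm_add]
    exact Nat.add_choose_mul_factorial_mul_factorial a b

theorem insertTop_shuffle_leftPos {a b : ℕ} (S : {S : Finset (Fin (a + b)) // #S = a})
    (σ : Equiv.Perm (Fin a)) (τ : Equiv.Perm (Fin b)) (k : Fin a) :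
    insertTop (midPos a b) (shuffle S σ τ) (leftPos a b k) =
      (S.1.orderEmbOfFin S.2 (σ k)).castSucc := by
  have : leftPos a b k = (midPos a b).succAbove (Fin.castAdd b k) := by
    rw [Fin.succAbove_of_castSucc_lt _ _ (by simp [midPos, Fin.lt_def])]
    rfl
  rw [this, insertTop_succAbove, shuffle_castAdd]

theorem insertTop_shuffle_rightPos {a b : ℕ} (S : {S : Finset (Fin (a + b)) // #S = a})
    (σ : Equiv.Perm (Fin a)) (τ : Equiv.Perm (Fin b)) (k : Fin b) :
    insertTop (midPos a b) (shuffle S σ τ) (rightPos a b k) =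
      (S.1ᶜ.orderEmbOfFin (by rw [card_compl, S.2, Fintype.card_fin]; omega) (τ k)).castSucc := by
  have : rightPos a b k = (midPos a b).succAbove (Fin.natAdd a k) := by
    rw [Fin.succAbove_of_le_castSucc _ _ (by simp [midPos, Fin.le_def])]
    simp [rightPos, Fin.ext_iff]; omega
  rw [this, insertTop_succAbove, shuffle_natAdd]

open Classical in
theorem weight_insertTop_shuffle {a b : ℕ} (S : {S : Finset (Fin (a + b)) // #S = a})
    (σ : Equiv.Perm (Fin a)) (τ : Equiv.Perm (Fin b)) (c : ℕ) (p q : ℂ) :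
    weight c (insertTop (midPos a b) (shuffle S σ τ)) p q =
      if a + b = 0 ∨ Odd (a + c) then
        p * q * (weight c σ p 1 * weight (c + a + 1) τ 1 q) else 0 := by
  rw [weight_split (fun i hi => ?_)]
  · simp only [insertTop_shuffle_leftPos, insertTop_shuffle_rightPos]
    rw [weight_comp_strictMono (g := fun x => (S.1.orderEmbOfFin S.2 x).castSucc)
        (fun x y h => by simpa using h),
      weight_comp_strictMono (g := fun x => (S.1ᶜ.orderEmbOfFin _ x).castSucc)
        (fun x y h => by simpa using h)]
  · rw [insertTop_self]
    refine lt_of_le_of_ne (Fin.le_last _) fun h => hi ?_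
    rw [← insertTop_self (midPos a b) (shuffle S σ τ)] at h
    exact (Equiv.injective _) h

theorem sum_weight_insertTop (a b c : ℕ) (p q : ℂ) :
    ∑ ρ : Equiv.Perm (Fin (a + b)), weight c (insertTop (midPos a b) ρ) p q =
      if a + b = 0 ∨ Odd (a + c) then
        p * q * ((a + b).choose a * altPoly c a p 1 * altPoly 0 b 1 q) else 0 := by
  classical
  rw [← (bijective_shuffle a b).sum_comp]
  simp only [weight_insertTop_shuffle]
  split_ifs with h
  · have hτ (τ : Equiv.Perm (Fin b)) : weight (c + a + 1) τ 1 q = weight 0 τ 1 q := by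
      -- The right side starts at a valley, so its phase is even, unless it is empty.
      rcases h with h | h
      · obtain rfl : b = 0 := by omega
        simp [weight, Alternates]
      · obtain ⟨k, hk⟩ := h
        rw [show c + a + 1 = 0 + 2 * (k + 1) by omega, weight_add_two_mul]
    simp only [hτ]
    simp only [Fintype.sum_prod_type, ← mul_sum, ← sum_mul, sum_const, card_univ,
      Fintype.card_finset_len, Fintype.card_fin, altPoly, nsmul_eq_mul]
    ring
  · simp

/-- The recursion that comes from splitting a permutation at its largest letter. -/
theorem altPoly_succ (c n : ℕ) (p q : ℂ) :
    altPoly c (n + 1) p q = p * q * ∑ i ∈ range (n + 1), if n = 0 ∨ Odd (i + c) then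
      n.choose i * altPoly c i p 1 * altPoly 0 (n - i) 1 q else 0 := by
  rw [altPoly, ← (bijective_insertTop n).sum_comp, Fintype.sum_prod_type, mul_sum,
    ← Fin.sum_univ_eq_sum_range (fun i => p * q * if n = 0 ∨ Odd (i + c) then
      n.choose i * altPoly c i p 1 * altPoly 0 (n - i) 1 q else 0)]
  refine sum_congr rfl fun i _ => ?_
  obtain ⟨a, ha⟩ := i
  obtain ⟨b, rfl⟩ : ∃ b, n = a + b := ⟨n - a, by omega⟩
  refine (sum_weight_insertTop a b c p q).trans ?_
  simp only [Nat.add_sub_cancel_left, mul_ite, mul_zero]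

theorem altPoly_zero (c : ℕ) (p q : ℂ) : altPoly c 0 p q = 1 := by
  simp [altPoly, weight, Alternates, leftMax, rightMax]


/-! ### The four recursions -/

/-- The numbers `altPoly c n p q` for even `n`, with zeros at the odd places. -/
noncomputable def evenSeq (c : ℕ) (p q : ℂ) (n : ℕ) : ℂ := if Even n then altPoly c n p q else 0

/-- The numbers `altPoly c n p q` for odd `n`, with zeros at the even places. -/
noncomputable def oddSeq (c : ℕ) (p q : ℂ) (n : ℕ) : ℂ := if Odd n then altPoly c n p q else 0

theorem evenSeq_zero (c : ℕ) (p q : ℂ) : evenSeq c p q 0 = 1 := by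
  simp [evenSeq, altPoly_zero]

theorem oddSeq_zero (c : ℕ) (p q : ℂ) : oddSeq c p q 0 = 0 := by
  simp [oddSeq]

theorem evenSeq_upDown_succ (p q : ℂ) (n : ℕ) :
    evenSeq 0 p q (n + 1) = p * q * ∑ i ∈ range (n + 1),
      n.choose i * oddSeq 0 p 1 i * evenSeq 0 1 q (n - i) := by
  rw [evenSeq]
  split_ifs with h
  · rw [altPoly_succ]
    congr 1
    refine sum_congr rfl fun i hi => ?_
    have hi := mem_range.1 hi
    by_cases hi' : Odd i
    · have h1 : Even (n - i) := by grind
      simp [oddSeq, evenSeq, hi', h1]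
    · have h1 : n ≠ 0 := by grind
      simp [oddSeq, hi', h1]
  · rw [sum_eq_zero, mul_zero]
    intro i hi
    have hi := mem_range.1 hi
    by_cases hi' : Odd i
    · have h1 : ¬ Even (n - i) := by grind
      simp [evenSeq, h1]
    · simp [oddSeq, hi']

/-- The inhomogeneous term is the permutation of length `1`, whose largest letter stands at a
valley. -/
theorem oddSeq_upDown_succ (p q : ℂ) (n : ℕ) :
    oddSeq 0 p q (n + 1) = (if n = 0 then p * q else 0) + p * q * ∑ i ∈ range (n + 1),
      n.choose i * oddSeq 0 p 1 i * oddSeq 0 1 q (n - i) := by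
  rcases Nat.eq_zero_or_pos n with rfl | hn
  · simp [oddSeq, altPoly_succ, altPoly_zero]
  rw [if_neg hn.ne', zero_add, oddSeq]
  split_ifs with h
  · rw [altPoly_succ]
    congr 1
    refine sum_congr rfl fun i hi => ?_
    have hi := mem_range.1 hi
    by_cases hi' : Odd i
    · have h1 : Odd (n - i) := by grind
      simp [oddSeq, hi', h1]
    · simp [oddSeq, hi', hn.ne']
  · rw [sum_eq_zero, mul_zero]
    intro i hi
    have hi := mem_range.1 hi
    by_cases hi' : Odd i
    · have h1 : ¬ Odd (n - i) := by grind
      simp only [oddSeq, h1, if_false, mul_zero]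
    · simp [oddSeq, hi']

theorem evenSeq_downUp_succ (p q : ℂ) (n : ℕ) :
    evenSeq 1 p q (n + 1) = p * q * ∑ i ∈ range (n + 1),
      n.choose i * evenSeq 1 p 1 i * oddSeq 0 1 q (n - i) := by
  rw [evenSeq]
  split_ifs with h
  · rw [altPoly_succ]
    congr 1
    refine sum_congr rfl fun i hi => ?_
    have hi := mem_range.1 hi
    by_cases hi' : Even i
    · have h1 : Odd (n - i) := by grind
      simp [oddSeq, evenSeq, hi', h1, hi'.add_one]
    · have h1 : n ≠ 0 := by grind
      have h2 : ¬ Odd (i + 1) := by grind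
      simp [evenSeq, hi', h1, h2]
  · rw [sum_eq_zero, mul_zero]
    intro i hi
    have hi := mem_range.1 hi
    by_cases hi' : Even i
    · have h1 : ¬ Odd (n - i) := by grind
      simp [oddSeq, h1]
    · simp [evenSeq, hi']

theorem oddSeq_downUp_succ (p q : ℂ) (n : ℕ) :
    oddSeq 1 p q (n + 1) = p * q * ∑ i ∈ range (n + 1),
      n.choose i * evenSeq 1 p 1 i * evenSeq 0 1 q (n - i) := by
  rw [oddSeq]
  split_ifs with h
  · rw [altPoly_succ]
    congr 1
    refine sum_congr rfl fun i hi => ?_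
    have hi := mem_range.1 hi
    by_cases hi' : Even i
    · have h1 : Even (n - i) := by grind
      simp [evenSeq, hi', h1, hi'.add_one]
    · have h1 : n ≠ 0 := by grind
      have h2 : ¬ Odd (i + 1) := by grind
      simp [evenSeq, hi', h1, h2]
  · rw [sum_eq_zero, mul_zero]
    intro i hi
    have hi := mem_range.1 hi
    by_cases hi' : Even i
    · have h1 : ¬ Even (n - i) := by grind
      simp only [evenSeq, h1, if_false, mul_zero]
    · simp [evenSeq, hi']

/-! ### Exponential generating functions on the disc -/

/-- The open disc of radius `π / 2` about `0`. -/
abbrev disc : Set ℂ := Metric.ball 0 (Real.pi / 2)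

theorem disc_mem_nhds : disc ∈ nhds (0 : ℂ) :=
  Metric.ball_mem_nhds _ (by positivity)

/-- `f` is holomorphic on the disc and its Taylor series at `0` is the exponential generating
function of `a`. -/
def IsEGF (f : ℂ → ℂ) (a : ℕ → ℂ) : Prop :=
  DifferentiableOn ℂ f disc ∧ ∀ n, iteratedDeriv n f 0 = a n

theorem IsEGF.hasSum {f : ℂ → ℂ} {a : ℕ → ℂ} (h : IsEGF f a) {t : ℂ} (ht : t ∈ disc) :
    HasSum (fun n => a n * (t ^ n / (Nat.factorial n : ℂ))) (f t) := by
  convert! Complex.hasSum_taylorSeries_on_ball h.1 ht using 2 with n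
  rw [h.2, sub_zero, smul_eq_mul, smul_eq_mul, div_eq_mul_inv]
  ring

theorem contDiffAt_zero {f : ℂ → ℂ} (hf : DifferentiableOn ℂ f disc) (n : WithTop ℕ∞) :
    ContDiffAt ℂ n f 0 :=
  (hf.analyticAt disc_mem_nhds).contDiffAt

theorem iteratedDeriv_succ_eq_sum {f u v : ℂ → ℂ} {c d : ℂ} (hu : DifferentiableOn ℂ u disc)
    (hv : DifferentiableOn ℂ v disc) (hf : ∀ z ∈ disc, HasDerivAt f (d + c * (u z * v z)) z)
    (n : ℕ) :
    iteratedDeriv (n + 1) f 0 = (if n = 0 then d else 0) + c * ∑ i ∈ range (n + 1),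
      n.choose i * iteratedDeriv i u 0 * iteratedDeriv (n - i) v 0 := by
  have h : deriv f =ᶠ[nhds 0] fun z => d + c * (u z * v z) := by
    filter_upwards [disc_mem_nhds] with z hz using (hf z hz).deriv
  have hcu := contDiffAt_zero hu n
  have hcv := contDiffAt_zero hv n
  rw [iteratedDeriv_succ', h.iteratedDeriv_eq,
    iteratedDeriv_fun_add contDiffAt_const (contDiffAt_const.mul (hcu.mul hcv)),
    iteratedDeriv_const, iteratedDeriv_const_mul_field, iteratedDeriv_fun_mul hcu hcv]

/-- If `f' = d + c u v` and the Taylor coefficients of `f` up to order `n` determine those of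
`u` and `v` up to order `n`, then a sequence with the matching binomial recursion is the sequence
of Taylor coefficients of `f`. The factors `u` and `v` may be known beforehand or be `f` itself. -/
theorem isEGF_of_hasDerivAt {f u v : ℂ → ℂ} {a b b' : ℕ → ℂ} {c d : ℂ}
    (hu : DifferentiableOn ℂ u disc) (hv : DifferentiableOn ℂ v disc)
    (hf : ∀ z ∈ disc, HasDerivAt f (d + c * (u z * v z)) z)
    (hub : ∀ n, iteratedDeriv n f 0 = a n → iteratedDeriv n u 0 = b n)
    (hvb : ∀ n, iteratedDeriv n f 0 = a n → iteratedDeriv n v 0 = b' n)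
    (h0 : f 0 = a 0)
    (ha : ∀ n, a (n + 1) = (if n = 0 then d else 0) + c * ∑ i ∈ range (n + 1),
      n.choose i * b i * b' (n - i)) :
    IsEGF f a := by
  refine ⟨fun z hz => (hf z hz).differentiableAt.differentiableWithinAt, fun n => ?_⟩
  induction n using Nat.strong_induction_on with
  | _ n ih =>
    cases n with
    | zero => rw [iteratedDeriv_zero, h0]
    | succ n =>
      rw [iteratedDeriv_succ_eq_sum hu hv hf, ha]
      congr 2
      refine sum_congr rfl fun i hi => ?_
      have hi := mem_range.1 hi
      rw [hub i (ih i hi), hvb (n - i) (ih _ (by omega))]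

/-! ### Integration along segments -/

/-- On the disc, `integralTo · f` is the primitive of a holomorphic `f` that vanishes at `0`. -/
theorem hasDerivAt_integralTo {f : ℂ → ℂ} (hf : DifferentiableOn ℂ f disc) {w : ℂ}
    (hw : w ∈ disc) : HasDerivAt (fun w => integralTo w f) (f w) w := by
  obtain ⟨g, hg⟩ := hf.isExactOn_ball
  have hseg : ∀ w ∈ disc, ∀ u ∈ Set.uIcc (0 : ℝ) 1, (u : ℂ) * w ∈ disc := by
    intro w hw u hu
    rw [Set.uIcc_of_le zero_le_one] at hu
    rw [mem_ball_zero_iff] at hw ⊢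
    rw [norm_mul, Complex.norm_real, Real.norm_of_nonneg hu.1]
    exact (mul_le_of_le_one_left (norm_nonneg _) hu.2).trans_lt hw
  have hint : ∀ w ∈ disc, integralTo w f = g w - g 0 := by
    intro w hw
    have hderiv : ∀ u ∈ Set.uIcc (0 : ℝ) 1,
        HasDerivAt (fun u : ℝ => g ((u : ℂ) * w)) (f ((u : ℂ) * w) * w) u := by
      intro u hu
      have h1 : HasDerivAt (fun x : ℝ => (x : ℂ) * w) w u := by
        simpa using Complex.ofRealCLM.hasDerivAt.mul_const w
      exact (hg _ (hseg w hw u hu)).comp u h1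
    rw [integralTo, intervalIntegral.integral_eq_sub_of_hasDerivAt hderiv]
    · simp
    · refine ContinuousOn.intervalIntegrable (ContinuousOn.mul ?_ continuousOn_const)
      exact hf.continuousOn.comp (by fun_prop) (hseg w hw)
  refine ((hg w hw).sub_const (g 0)).congr_of_eventuallyEq ?_
  filter_upwards [Metric.isOpen_ball.mem_nhds hw] with z hz using hint z hz

theorem integralTo_zero (f : ℂ → ℂ) : integralTo 0 f = 0 := by
  simp [integralTo]

theorem integralTo_const_mul (c w : ℂ) (f : ℂ → ℂ) :
    integralTo (c * w) f = c * integralTo w (fun z => f (c * z)) := by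
  rw [integralTo, integralTo, ← intervalIntegral.integral_const_mul]
  refine intervalIntegral.integral_congr fun u _ => ?_
  simp only [mul_left_comm (u : ℂ) c w]
  ring

/-- The substitution `s = c z` in an integral along a segment. -/
theorem hasDerivAt_integralTo_const_mul {f g : ℂ → ℂ} {c : ℂ} (hfg : ∀ z, f (c * z) = g z)
    (hg : DifferentiableOn ℂ g disc) {w : ℂ} (hw : w ∈ disc) :
    HasDerivAt (fun w => integralTo (c * w) f) (c * g w) w := by
  simp only [integralTo_const_mul, hfg]
  exact (hasDerivAt_integralTo hg hw).const_mul c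

/-! ### Powers of the secant -/

/-- The real part of `cos (x + i y)` is `cos x cosh y`. -/
theorem cos_re_pos {z : ℂ} (hz : z ∈ disc) : 0 < (Complex.cos z).re := by
  rw [mem_ball_zero_iff] at hz
  have hx := abs_lt.1 ((Complex.abs_re_le_norm z).trans_lt hz)
  have h : (Complex.cos z).re = Real.cos z.re * Real.cosh z.im := by
    rw [Complex.cos_eq, ← Complex.ofReal_cos, ← Complex.ofReal_cosh, ← Complex.ofReal_sin,
      ← Complex.ofReal_sinh]
    simp [-Complex.ofReal_cos, -Complex.ofReal_cosh, -Complex.ofReal_sin, -Complex.ofReal_sinh]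
  rw [h]
  exact mul_pos (Real.cos_pos_of_mem_Ioo hx) (Real.cosh_pos _)

theorem cos_ne_zero {z : ℂ} (hz : z ∈ disc) : Complex.cos z ≠ 0 := fun h => by
  simpa [h] using cos_re_pos hz

theorem sec_ne_zero {z : ℂ} (hz : z ∈ disc) : sec z ≠ 0 := inv_ne_zero (cos_ne_zero hz)

theorem sec_zero_cpow (p : ℂ) : sec 0 ^ p = 1 := by simp [sec]

theorem sec_mem_slitPlane {z : ℂ} (hz : z ∈ disc) : sec z ∈ Complex.slitPlane := by
  left
  rw [sec, Complex.inv_re]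
  exact div_pos (cos_re_pos hz) (Complex.normSq_pos.2 (cos_ne_zero hz))

theorem hasDerivAt_sec_cpow (p : ℂ) {z : ℂ} (hz : z ∈ disc) :
    HasDerivAt (fun z => sec z ^ p) (p * (sec z ^ p * Complex.tan z)) z := by
  have h1 : HasDerivAt sec (sec z * Complex.tan z) z := by
    refine ((Complex.hasDerivAt_cos z).inv (cos_ne_zero hz)).congr_deriv ?_
    simp only [sec]
    rw [ Complex.tan_eq_sin_div_cos]
    field_simp
  refine (h1.cpow_const (c := p) (sec_mem_slitPlane hz)).congr_deriv ?_
  rw [Complex.cpow_sub _ _ (sec_ne_zero hz), Complex.cpow_one]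
  field_simp [sec_ne_zero hz]

theorem differentiableOn_sec_cpow (p : ℂ) : DifferentiableOn ℂ (fun z => sec z ^ p) disc :=
  fun _ hz => (hasDerivAt_sec_cpow p hz).differentiableAt.differentiableWithinAt

theorem hasDerivAt_tan_disc {z : ℂ} (hz : z ∈ disc) :
    HasDerivAt Complex.tan (1 + 1 * (Complex.tan z * Complex.tan z)) z := by
  refine (Complex.hasDerivAt_tan (cos_ne_zero hz)).congr_deriv ?_
  have h := cos_ne_zero hz
  rw [Complex.tan_eq_sin_div_cos]
  field_simp
  linear_combination -Complex.sin_sq_add_cos_sq z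

theorem differentiableOn_tan : DifferentiableOn ℂ Complex.tan disc :=
  fun _ hz => (hasDerivAt_tan_disc hz).differentiableAt.differentiableWithinAt

/-- `∫₀^{pw} sec(z/p)^{-p} dz`, a primitive of `p cos(w)^p`. -/
noncomputable def cosIntegral (p w : ℂ) : ℂ := integralTo (p * w) fun z => sec (z / p) ^ (-p)

theorem hasDerivAt_cosIntegral {p : ℂ} (hp : p ≠ 0) {w : ℂ} (hw : w ∈ disc) :
    HasDerivAt (cosIntegral p) (p * sec w ^ (-p)) w :=
  hasDerivAt_integralTo_const_mul (fun z => by rw [mul_div_cancel_left₀ z hp])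
    (differentiableOn_sec_cpow (-p)) hw

theorem differentiableOn_cosIntegral {p : ℂ} (hp : p ≠ 0) :
    DifferentiableOn ℂ (cosIntegral p) disc :=
  fun _ hz => (hasDerivAt_cosIntegral hp hz).differentiableAt.differentiableWithinAt

/-- `sec^p ∫ p cos^p` solves `f' = p + p f tan`, by variation of constants. -/
theorem hasDerivAt_sec_cpow_mul_cosIntegral {p : ℂ} (hp : p ≠ 0) {z : ℂ} (hz : z ∈ disc) :
    HasDerivAt (fun z => sec z ^ p * cosIntegral p z)
      (p + p * (sec z ^ p * cosIntegral p z * Complex.tan z)) z := by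
  refine ((hasDerivAt_sec_cpow p hz).mul (hasDerivAt_cosIntegral hp hz)).congr_deriv ?_
  have h : sec z ^ p * sec z ^ (-p) = 1 := by
    rw [← Complex.cpow_add _ _ (sec_ne_zero hz), add_neg_cancel, Complex.cpow_zero]
  linear_combination p * h

/-! ### One-sided generating functions -/

theorem isEGF_tan : IsEGF Complex.tan (oddSeq 0 1 1) :=
  isEGF_of_hasDerivAt differentiableOn_tan differentiableOn_tan (fun _ => hasDerivAt_tan_disc)
    (fun _ h => h) (fun _ h => h) (by simp [oddSeq_zero])
    fun n => by simpa using oddSeq_upDown_succ 1 1 n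

theorem isEGF_sec_cpow_downUp (p : ℂ) : IsEGF (fun z => sec z ^ p) (evenSeq 1 p 1) :=
  isEGF_of_hasDerivAt (d := 0) (differentiableOn_sec_cpow p) differentiableOn_tan
    (fun _ hz => by simpa using hasDerivAt_sec_cpow p hz)
    (fun _ h => h) (fun n _ => isEGF_tan.2 n) (by simp [evenSeq_zero, sec_zero_cpow])
    fun n => by simpa using evenSeq_downUp_succ p 1 n

theorem isEGF_sec_cpow_upDown (q : ℂ) : IsEGF (fun z => sec z ^ q) (evenSeq 0 1 q) :=
  isEGF_of_hasDerivAt (d := 0) differentiableOn_tan (differentiableOn_sec_cpow q)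
    (fun z hz => by simpa [mul_comm (Complex.tan z)] using hasDerivAt_sec_cpow q hz)
    (fun n _ => isEGF_tan.2 n) (fun _ h => h) (by simp [evenSeq_zero, sec_zero_cpow])
    fun n => by simpa using evenSeq_upDown_succ 1 q n

theorem isEGF_sec_cpow_mul_cosIntegral_left {p : ℂ} (hp : p ≠ 0) :
    IsEGF (fun z => sec z ^ p * cosIntegral p z) (oddSeq 0 p 1) :=
  isEGF_of_hasDerivAt ((differentiableOn_sec_cpow p).mul (differentiableOn_cosIntegral hp))
    differentiableOn_tan (fun _ => hasDerivAt_sec_cpow_mul_cosIntegral hp)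
    (fun _ h => h) (fun n _ => isEGF_tan.2 n) (by simp [oddSeq_zero, cosIntegral, integralTo_zero])
    fun n => by simpa using oddSeq_upDown_succ p 1 n

theorem isEGF_sec_cpow_mul_cosIntegral_right {q : ℂ} (hq : q ≠ 0) :
    IsEGF (fun z => sec z ^ q * cosIntegral q z) (oddSeq 0 1 q) :=
  isEGF_of_hasDerivAt differentiableOn_tan
    ((differentiableOn_sec_cpow q).mul (differentiableOn_cosIntegral hq))
    (fun z hz => by
      simpa [mul_comm (Complex.tan z)] using hasDerivAt_sec_cpow_mul_cosIntegral hq hz)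
    (fun n _ => isEGF_tan.2 n) (fun _ h => h) (by simp [oddSeq_zero, cosIntegral, integralTo_zero])
    fun n => by simpa using oddSeq_upDown_succ 1 q n

/-! ### The joint generating functions -/

/-- If `u` and `v` are the generating functions of the left and the right side and
`f (c z) = u z * v z`, then `∫₀^{ct} f` is, up to the initial terms `e + d t`, the generating
function of the joint distribution. -/
theorem isEGF_integralTo {f u v : ℂ → ℂ} {a b b' : ℕ → ℂ} {c d e : ℂ} (hu : IsEGF u b)
    (hv : IsEGF v b') (hf : ∀ z ∈ disc, f (c * z) = u z * v z) (h0 : a 0 = e)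
    (ha : ∀ n, a (n + 1) = (if n = 0 then d else 0) + c * ∑ i ∈ range (n + 1),
      n.choose i * b i * b' (n - i)) :
    IsEGF (fun t => e + d * t + integralTo (c * t) f) a := by
  refine isEGF_of_hasDerivAt hu.1 hv.1 (fun z hz => ?_) (fun n _ => hu.2 n) (fun n _ => hv.2 n)
    (by simp [h0, integralTo_zero]) ha
  have h1 := ((hasDerivAt_id z).const_mul d).const_add e
  have h2 := hasDerivAt_integralTo_const_mul (f := f) (c := c) (g := fun z => f (c * z))
    (fun _ => rfl) ((hu.1.mul hv.1).congr hf) hz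
  refine (h1.add h2).congr_deriv ?_
  rw [hf z hz, mul_one]

theorem hasSum_even {f : ℂ → ℂ} {c : ℕ} {p q : ℂ} (h : IsEGF f (evenSeq c p q)) {t : ℂ}
    (ht : t ∈ disc) :
    HasSum (fun k : ℕ => altPoly c (2 * k + 2) p q *
      (t ^ (2 * k + 2) / (Nat.factorial (2 * k + 2) : ℂ))) (f t - 1) := by
  have h1 := (hasSum_nat_add_iff' 1).2 (h.hasSum ht)
  have hinj : Function.Injective fun k : ℕ => 2 * k + 1 := fun a b hab => by
    simpa using hab
  rw [← hinj.hasSum_iff] at h1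
  · convert! h1 using 1
    · funext k
      have : Even (2 * k + 1 + 1) := by grind
      simp [evenSeq, this]
    · simp [evenSeq_zero]
  · intro n hn
    have : ¬ Even (n + 1) := fun h => hn ⟨n / 2, by grind⟩
    simp [evenSeq, this]

theorem hasSum_odd {f : ℂ → ℂ} {c : ℕ} {p q : ℂ} (h : IsEGF f (oddSeq c p q)) {t : ℂ}
    (ht : t ∈ disc) :
    HasSum (fun k : ℕ => altPoly c (2 * k + 1) p q *
      (t ^ (2 * k + 1) / (Nat.factorial (2 * k + 1) : ℂ))) (f t) := by
  have h1 := h.hasSum ht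
  have hinj : Function.Injective fun k : ℕ => 2 * k + 1 := fun a b hab => by
    simpa using hab
  rw [← hinj.hasSum_iff] at h1
  · convert! h1 using 1
    funext k
    have : Odd (2 * k + 1) := by grind
    simp [oddSeq, this]
  · intro n hn
    have : ¬ Odd n := fun ⟨m, hm⟩ => hn ⟨m, hm.symm⟩
    simp [oddSeq, this]

theorem sec_cpow_add {z : ℂ} (hz : z ∈ disc) (p q : ℂ) : sec z ^ (p + q) = sec z ^ p * sec z ^ q :=
  Complex.cpow_add _ _ (sec_ne_zero hz)

theorem integralTo_sec_eq_cosIntegral {p q : ℂ} (hq : q ≠ 0) (z : ℂ) :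
    integralTo (p * q * z / q) (fun z => sec (z / p) ^ (-p)) = cosIntegral p z := by
  rw [cosIntegral, mul_right_comm, mul_div_cancel_right₀ _ hq]

end AltPerm

theorem mainTheorem5 (p q t : ℂ) (hp : p ≠ 0) (hq : q ≠ 0) (ht : ‖t‖ < Real.pi / 2) :
    (Summable (AltPerm.term1 t p q) ∧
      AltPerm.G1 t p q =
        1 + AltPerm.integralTo (p * q * t) (fun s =>
          AltPerm.sec (s / (p * q)) ^ (p + q) *
            AltPerm.integralTo (s / q) (fun z => AltPerm.sec (z / p) ^ (-p)))) ∧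
    (Summable (AltPerm.term2 t p q) ∧
      AltPerm.G2 t p q =
        p * q * t + AltPerm.integralTo (p * q * t) (fun s =>
          AltPerm.sec (s / (p * q)) ^ (p + q) *
            AltPerm.integralTo (s / q) (fun z => AltPerm.sec (z / p) ^ (-p)) *
            AltPerm.integralTo (s / p) (fun z => AltPerm.sec (z / q) ^ (-q)))) ∧
    (Summable (AltPerm.term3 t p q) ∧
      AltPerm.G3 t p q =
        1 + AltPerm.integralTo (p * q * t) (fun s =>
          AltPerm.sec (s / (p * q)) ^ (p + q) *
            AltPerm.integralTo (s / p) (fun z => AltPerm.sec (z / q) ^ (-q)))) ∧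
    (Summable (AltPerm.term4 t p q) ∧
      AltPerm.G4 t p q =
        AltPerm.integralTo (p * q * t) (fun z => AltPerm.sec (z / (p * q)) ^ (p + q))) := by
  have ht : t ∈ AltPerm.disc := mem_ball_zero_iff.2 ht
  have hpq : p * q ≠ 0 := mul_ne_zero hp hq
  have hsec (z : ℂ) : AltPerm.sec (p * q * z / (p * q)) = AltPerm.sec z := by
    rw [mul_div_cancel_left₀ z hpq]
  have hIp (z : ℂ) := AltPerm.integralTo_sec_eq_cosIntegral (p := p) hq z
  have hIq (z : ℂ) : AltPerm.integralTo (p * q * z / p) (fun z => AltPerm.sec (z / q) ^ (-q)) =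
      AltPerm.cosIntegral q z := by
    rw [mul_comm p q]
    exact AltPerm.integralTo_sec_eq_cosIntegral hp z
  have hOp := AltPerm.isEGF_sec_cpow_mul_cosIntegral_left hp
  have hOq := AltPerm.isEGF_sec_cpow_mul_cosIntegral_right hq
  have hEp := AltPerm.isEGF_sec_cpow_downUp p
  have hEq := AltPerm.isEGF_sec_cpow_upDown q
  have h1 := AltPerm.hasSum_even (AltPerm.isEGF_integralTo (c := p * q) (d := 0) (f := fun s =>
    AltPerm.sec (s / (p * q)) ^ (p + q) *
      AltPerm.integralTo (s / q) (fun z => AltPerm.sec (z / p) ^ (-p))) hOp hEq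
    (fun z hz => by
      simp only [hsec, hIp, AltPerm.sec_cpow_add hz]
      ring)
    (AltPerm.evenSeq_zero 0 p q) fun n => by simpa using AltPerm.evenSeq_upDown_succ p q n) ht
  have h2 := AltPerm.hasSum_odd (AltPerm.isEGF_integralTo (c := p * q) (f := fun s =>
    AltPerm.sec (s / (p * q)) ^ (p + q) *
      AltPerm.integralTo (s / q) (fun z => AltPerm.sec (z / p) ^ (-p)) *
      AltPerm.integralTo (s / p) (fun z => AltPerm.sec (z / q) ^ (-q))) hOp hOq
    (fun z hz => by
      simp only [hsec, hIp, hIq, AltPerm.sec_cpow_add hz]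
      ring)
    (AltPerm.oddSeq_zero 0 p q) (AltPerm.oddSeq_upDown_succ p q)) ht
  have h3 := AltPerm.hasSum_even (AltPerm.isEGF_integralTo (c := p * q) (d := 0) (f := fun s =>
    AltPerm.sec (s / (p * q)) ^ (p + q) *
      AltPerm.integralTo (s / p) (fun z => AltPerm.sec (z / q) ^ (-q))) hEp hOq
    (fun z hz => by
      simp only [hsec, hIq, AltPerm.sec_cpow_add hz]
      ring)
    (AltPerm.evenSeq_zero 1 p q) fun n => by simpa using AltPerm.evenSeq_downUp_succ p q n) ht
  have h4 := AltPerm.hasSum_odd (AltPerm.isEGF_integralTo (c := p * q) (d := 0) (f := fun s =>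
    AltPerm.sec (s / (p * q)) ^ (p + q)) hEp hEq
    (fun z hz => by simp only [hsec, AltPerm.sec_cpow_add hz])
    (AltPerm.oddSeq_zero 1 p q) fun n => by simpa using AltPerm.oddSeq_downUp_succ p q n) ht
  simp only [← AltPerm.udPoly_eq_altPoly] at h1 h2
  simp only [← AltPerm.duPoly_eq_altPoly] at h3 h4
  simp only [zero_mul, add_zero, zero_add, add_sub_cancel_left] at h1 h2 h3 h4
  exact ⟨⟨h1.summable, congrArg (1 + ·) h1.tsum_eq⟩, ⟨h2.summable, h2.tsum_eq⟩,
    ⟨h3.summable, congrArg (1 + ·) h3.tsum_eq⟩, h4.summable, h4.tsum_eq⟩
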